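/- A chord diagram $D$ of degree $n$ on a two-component string link consists of two oriented line segments together with $n$ chords whose $2n$ endpoints are distinct points of the segments; it is determined by the orders of the endpoints along the segments. Its intersection graph $\Gamma(D)$ is the directed graph with one vertex for each chord, labeled by the unordered pair of the components that carry the endpoints of the chord, and with a directed edge from $v$ to $w$ ($v\neq w$) if and only if the number of pairs $(e_1,e_2)$, where $e_1$ is an endpoint of the chord $v$, $e_2$ is an endpoint of the chord $w$, and $e_1$ lies below $e_2$ on the same component, is odd. The adjacency matrix of $\Gamma(D)$ over $\mathbb{Z}/2$ has off-diagonal entries $1$ where there is a directed edge and $0$ elsewhere; a diagonal entry is $1$ if the chord joins different components and $0$ if both its endpoints lie on the same component. Let $\det(\Gamma(D))$ and $\mathrm{rank}(\Gamma(D))$ be the determinant and the rank over $\mathbb{Z}/2$ of this matrix. Let $\Delta=\sum_{m\ge 0} a_m z^m$ be the Conway polynomial, determined by $\Delta(L_+)-\Delta(L_-)=z\,\Delta(L_0)$ and by the values $1$ on the unknot and $0$ on unlinks with several components. It is evaluated on string links through their closures, and extended to singular string links by $v(\text{double point})=v(\text{positive crossing})-v(\text{negative crossing})$. The Conway weight system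 $C$ assigns to a chord diagram $D$ of degree $n$ the value of $a_n$ on any singular string link with $n$ double points whose chord diagram is $D$. It satisfies $C(D)=C(D_v)$, where $D_v$ is obtained from $D$ by surgery on the chord $v$ along an orientation-preserving band; so $C(D)=1$ if surgery on all chords followed by closing up the two segments yields exactly one circle, and $C(D)=0$ otherwise. **Theorem.** For every chord diagram $D$ on a string link with two components, $$C(D)=\det(\Gamma(D))\cdot \mathrm{rank}(\Gamma(D)) \pmod 2,$$ that is, $C(D)\in\{0,1\}$ is the residue modulo $2$ of the product of the determinant and the rank. -/

import Mathlib

open Polynomial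

/-- A chord diagram of degree `n` on `k` oriented line segments (the components of a string link).
Component `i` carries `size i` chord endpoints, numbered from bottom to top in the direction of
the orientation; chord `c` has the two endpoints `ends (c, false)` and `ends (c, true)`, and
every endpoint belongs to exactly one chord. -/
structure StringChordDiagram (k n : ℕ) where
  size : Fin k → ℕ
  ends : Fin n × Bool ≃ (Σ i : Fin k, Fin (size i))

/-- A directed graph on `V`, without multiple edges in the same direction, whose vertices are
labeled by unordered pairs of elements of `Fin k`. -/
structure LabeledDigraph (k : ℕ) (V : Type) where
  label : V → Sym2 (Fin k)
  edge : V → V → Prop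

open Classical in
/-- The adjacency matrix over `ℤ/2` of a labeled directed graph. Off the diagonal it records the
edges; a diagonal entry is `1` exactly when the two elements of the label differ. -/
noncomputable def LabeledDigraph.adj {k : ℕ} {V : Type} (G : LabeledDigraph k V) :
    Matrix V V (ZMod 2) :=
  Matrix.of fun v w =>
    if v = w then (if (G.label v).IsDiag then 0 else 1) else (if G.edge v w then 1 else 0)

namespace StringChordDiagram

variable {k n : ℕ} (D : StringChordDiagram k n)

/-- The component on which an endpoint lies. -/
def comp (x : Fin n × Bool) : Fin k := (D.ends x).1

/-- The height of an endpoint on its component. -/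
def height (x : Fin n × Bool) : ℕ := ((D.ends x).2 : ℕ)

open Classical in
/-- The number of pairs `(e₁, e₂)`, with `e₁` an endpoint of the chord `v` and `e₂` an endpoint of
the chord `w`, that lie on the same component with `e₁` below `e₂`. -/
noncomputable def edgeCount (v w : Fin n) : ℕ :=
  (Finset.univ.filter fun p : Bool × Bool =>
    D.comp (v, p.1) = D.comp (w, p.2) ∧ D.height (v, p.1) < D.height (w, p.2)).card

/-- The intersection graph: a vertex for each chord, labeled by the two components that carry its
endpoints; the directed edges between different vertices are counted modulo 2. -/
noncomputable def intersectionGraph : LabeledDigraph k (Fin n) where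
  label v := s(D.comp (v, false), D.comp (v, true))
  edge v w := v ≠ w ∧ Odd (D.edgeCount v w)

/-- The arcs into which the endpoints cut the `k` segments: the arc `j` of component `i` ends at
the endpoint `j`, and starts at the endpoint `j - 1` (at the bottom of the component if `j = 0`);
the last arc ends at the top of the component. They are ordered lexicographically. -/
abbrev Arc : Type := Σₗ i : Fin k, Fin (D.size i + 1)

/-- The arc that ends at the given endpoint. -/
def arcTo (e : Σ i : Fin k, Fin (D.size i)) : D.Arc := toLex ⟨e.1, e.2.castSucc⟩

/-- The arc that starts at the given endpoint. -/
def arcFrom (e : Σ i : Fin k, Fin (D.size i)) : D.Arc := toLex ⟨e.1, e.2.succ⟩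

open Classical in
/-- The arc that follows a given arc when the segments are closed up (the top of each component
is joined to its bottom) and the chords in `T` are surgered by bands that respect the
orientation: on reaching an endpoint of a chord in `T`, one goes on from its other endpoint. -/
noncomputable def next (T : Set (Fin n)) (a : D.Arc) : D.Arc :=
  let i : Fin k := (ofLex a).1
  if h : ((ofLex a).2 : ℕ) < D.size i then
    let x := D.ends.symm ⟨i, ⟨(ofLex a).2, h⟩⟩
    if x.1 ∈ T then D.arcFrom (D.ends (x.1, !x.2)) else D.arcFrom (D.ends x)
  else toLex ⟨i, 0⟩

/-- The number of circles after closing up the segments and surgering the chords in `T`. -/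
noncomputable def numCircles (T : Set (Fin n)) : ℕ :=
  Nat.card (Quot fun a b : D.Arc => D.next T a = b)

/-- The Conway weight system, as determined by `C(D) = C(D_v)` for the surgery `D_v` on any
chord `v`, and by `C = 1` on one circle and `C = 0` on several circles without chords. -/
noncomputable def conwayWeight : ℤ := if D.numCircles Set.univ = 1 then 1 else 0

end StringChordDiagram

/-- The underlying (flat) diagram of a `k`-component string link with `N` transverse double points
in the plane, by its Gauss data: the two preimages of each double point are joined by a chord, and
`posOver c` is the branch that runs above when the double point `c` is made a positive crossing
(so the other branch runs above when it is made a negative crossing). No planarity condition is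
imposed on the Gauss data, so the diagrams drawn in the plane are among these. -/
structure FlatStringDiagram (k N : ℕ) extends StringChordDiagram k N where
  posOver : Fin N → Bool

/-- What may be put in the place of a double point: a positive crossing, a negative crossing, or
the smoothing that respects the orientation. -/
inductive CrossingState where
  | pos
  | neg
  | smooth

namespace FlatStringDiagram

variable {k N : ℕ} (E : FlatStringDiagram k N)

/-- The set of smoothed double points. -/
def smoothed (s : Fin N → CrossingState) : Set (Fin N) := {c | s c = CrossingState.smooth}

/-- The number of components of the closure of the diagram `E` with crossings `s`. -/
noncomputable def numComponents (s : Fin N → CrossingState) : ℕ := E.numCircles (smoothed s)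

/-- Walk along the closure of the diagram with crossings `s`, taking as base point of each
component its least arc. `Visited s a b m`: the base arc of the component of `a` is `b`, and one
gets from `b` to `a` in `m` steps. -/
def Visited (s : Fin N → CrossingState) (a b : E.Arc) (m : ℕ) : Prop :=
  (∀ l, b ≤ (E.next (smoothed s))^[l] b) ∧
    (E.next (smoothed s))^[m] b = a ∧ ∀ l < m, (E.next (smoothed s))^[l] b ≠ a

/-- `a` is met before `a'` on the walk along all components in the order of their base arcs. -/
def Before (s : Fin N → CrossingState) (a a' : E.Arc) : Prop :=
  ∃ b m b' m', E.Visited s a b m ∧ E.Visited s a' b' m' ∧ (b < b' ∨ b = b' ∧ m < m')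

/-- The upper and the lower branch at `c` when the crossing there is positive are
`(c, posOver c)` and `(c, !posOver c)`; when it is negative, they are exchanged.
The link diagram is descending if the walk along it passes each crossing first on the upper
branch. A descending diagram is a diagram of an unlink. -/
def Descending (s : Fin N → CrossingState) : Prop :=
  ∀ c,
    (s c = CrossingState.pos →
      E.Before s (E.arcTo (E.ends (c, E.posOver c))) (E.arcTo (E.ends (c, !E.posOver c)))) ∧
    (s c = CrossingState.neg →
      E.Before s (E.arcTo (E.ends (c, !E.posOver c))) (E.arcTo (E.ends (c, E.posOver c))))

/-- `E.HasConway s p`: the Conway polynomial of the closure of the diagram `E` with crossings `s`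
is computed to be `p` by the skein relation `∇(L₊) - ∇(L₋) = z ∇(L₀)` from the values `1` on the
unlink with one component and `0` on the unlinks with several components. Crossing changes and
smoothings lead from every diagram to descending ones, and from diagrams drawn in the plane they
only lead to diagrams drawn in the plane. -/
inductive HasConway : (Fin N → CrossingState) → ℤ[X] → Prop
  | unlink (s : Fin N → CrossingState) (h : E.Descending s) :
      HasConway s (if E.numComponents s = 1 then 1 else 0)
  | skeinPos (s : Fin N → CrossingState) (c : Fin N) (p q : ℤ[X])
      (h : s c = CrossingState.pos)
      (hp : HasConway (Function.update s c CrossingState.neg) p)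
      (hq : HasConway (Function.update s c CrossingState.smooth) q) :
      HasConway s (p + X * q)
  | skeinNeg (s : Fin N → CrossingState) (c : Fin N) (p q : ℤ[X])
      (h : s c = CrossingState.neg)
      (hp : HasConway (Function.update s c CrossingState.pos) p)
      (hq : HasConway (Function.update s c CrossingState.smooth) q) :
      HasConway s (p - X * q)

open Classical in
/-- The Conway polynomial of the closure of the diagram `E` with crossings `s`. -/
noncomputable def conwayPolynomial (s : Fin N → CrossingState) : ℤ[X] :=
  if h : ∃ p, E.HasConway s p then h.choose else 0

end FlatStringDiagram

/-- A diagram of a singular string link with `k` components and exactly `n` double points. Among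
the `N` crossing points of the diagram, the points `double j` are the double points of the singular
string link, and every other point `c` is a crossing, positive if `sign c` is `true` and negative
otherwise (the value of `sign` at the points `double j` is irrelevant). -/
structure SingularStringLink (k n : ℕ) where
  N : ℕ
  diagram : FlatStringDiagram k N
  double : Fin n ↪ Fin N
  sign : Fin N → Bool

namespace SingularStringLink

variable {k n : ℕ} (S : SingularStringLink k n)

/-- The string link diagram obtained by resolving the double point `j` into a positive crossing if
`ε j` is `true`, and into a negative crossing otherwise. -/
noncomputable def resolve (ε : Fin n → Bool) : Fin S.N → CrossingState := fun c =>
  if Function.extend S.double ε S.sign c then CrossingState.pos else CrossingState.neg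

/-- The `m`-th coefficient of the Conway polynomial of the closure, extended to singular string
links by `v(double point) = v(positive crossing) - v(negative crossing)`. -/
noncomputable def conwayCoeff (m : ℕ) : ℤ :=
  ∑ ε : Fin n → Bool, (∏ j, if ε j then (1 : ℤ) else -1) *
    (S.diagram.conwayPolynomial (S.resolve ε)).coeff m

/-- `D` is the chord diagram of `S`: its chords join the preimages of the double points of `S`, in
the same order along each component. -/
def HasChordDiagram (D : StringChordDiagram k n) : Prop :=
  ∃ f : ∀ i, Fin (D.size i) → Fin (S.diagram.size i), (∀ i, StrictMono (f i)) ∧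
    ∀ j b, S.diagram.ends (S.double j, b) =
      ⟨(D.ends (j, b)).1, f _ (D.ends (j, b)).2⟩

end SingularStringLink

/-! Let `A` be the adjacency matrix and `d` its diagonal. Surgery leaves one circle iff every
`ℤ/2`-valued function constant along the circles is constant. Such a function jumps by the same
amount `x v` at both ends of a chord `v`, so it is determined by `x` and its values `c 0`, `c 1` at
the bottoms. Invariance becomes the system `A x = (c 0 + c 1) d`, `d · x = 0`
(`potential_next_iff`). Having two components makes `A` symmetric, so `A + d dᵀ` is alternating.
Since alternating matrices of odd size are singular, the system forces `x = 0` and `c 0 + c 1 = 0`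
iff `det A ≠ 0` and `n` is odd (`bordered_diag_injective_iff`). As a nonsingular `A` has rank `n`,
this says that `det A · rank A` is odd.

That this circle count is the coefficient `a_n` follows from a state sum over the sets `T` of
smoothed points that leave one circle. A crossing in `T` contributes `±X` if it is first met on its
lower branch, and `0` otherwise. For fixed `T` the skein relation holds termwise
(`stateWeight_skein`). On a descending diagram only the set of points already smoothed can
contribute (`stateSum_of_descending`), so every skein computation returns the state sum. The
alternating sum over resolutions of `n` double points is `X ^ n` times the state sum with these
points smoothed (`sum_resolve_stateSum`), whose constant term tests for one circle. Finally the
other crossings are deleted (`numCircles_range`). -/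

/-! ### Arcs and circles -/

namespace StringChordDiagram

variable {k n : ℕ} (D : StringChordDiagram k n)

/-- The first arc of a component. -/
def botArc (i : Fin k) : D.Arc := toLex ⟨i, 0⟩

/-- The last arc of a component. -/
def topArc (i : Fin k) : D.Arc := toLex ⟨i, Fin.last _⟩

open Classical in
/-- The endpoint from which one goes on after reaching `x`, when the chords in `T` are surgered. -/
noncomputable def jump (T : Set (Fin n)) (x : Fin n × Bool) : Fin n × Bool :=
  if x.1 ∈ T then (x.1, !x.2) else x

theorem jump_jump (T : Set (Fin n)) (x : Fin n × Bool) : jump T (jump T x) = x := by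
  by_cases h : x.1 ∈ T <;> simp [jump, h]

theorem next_arcTo (T : Set (Fin n)) (x : Fin n × Bool) :
    D.next T (D.arcTo (D.ends x)) = D.arcFrom (D.ends (jump T x)) := by
  by_cases h : x.1 ∈ T <;> simp [next, arcTo, jump, h]

theorem next_topArc (T : Set (Fin n)) (i : Fin k) : D.next T (D.topArc i) = D.botArc i := by
  simp [next, topArc, botArc]
  rfl

theorem arcTo_or_topArc (a : D.Arc) : (∃ x, a = D.arcTo (D.ends x)) ∨ ∃ i, a = D.topArc i := by
  obtain ⟨i, j⟩ := a
  induction j using Fin.lastCases with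
  | last => exact .inr ⟨i, rfl⟩
  | cast j =>
    obtain ⟨x, hx⟩ := D.ends.surjective ⟨i, j⟩
    exact .inl ⟨x, by rw [hx]; rfl⟩

theorem arcTo_injective : Function.Injective D.arcTo := by
  rintro ⟨i, j⟩ ⟨i', j'⟩ h
  obtain ⟨rfl, h⟩ := Sigma.mk.inj_iff.1 (toLex.injective h)
  simpa using h

theorem arcFrom_injective : Function.Injective D.arcFrom := by
  rintro ⟨i, j⟩ ⟨i', j'⟩ h
  obtain ⟨rfl, h⟩ := Sigma.mk.inj_iff.1 (toLex.injective h)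
  simpa using h

theorem botArc_injective : Function.Injective D.botArc := by
  intro i i' h
  exact (Sigma.mk.inj_iff.1 (toLex.injective h)).1

theorem arcFrom_ne_botArc (e : Σ i : Fin k, Fin (D.size i)) (i : Fin k) :
    D.arcFrom e ≠ D.botArc i := by
  obtain ⟨i', j'⟩ := e
  intro h
  obtain ⟨rfl, h⟩ := Sigma.mk.inj_iff.1 (toLex.injective h)
  exact Fin.succ_ne_zero _ (eq_of_heq h)

/-- The arcs being finite, `next` is a permutation: circles are its orbits, and walks can be
reversed. -/
theorem next_injective (T : Set (Fin n)) : Function.Injective (D.next T) := by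
  intro a b h
  obtain ⟨x, rfl⟩ | ⟨i, rfl⟩ := D.arcTo_or_topArc a <;>
  obtain ⟨y, rfl⟩ | ⟨j, rfl⟩ := D.arcTo_or_topArc b <;>
  simp only [next_arcTo, next_topArc] at h
  · have := D.ends.injective (D.arcFrom_injective h)
    rw [← jump_jump T x, this, jump_jump]
  · exact (D.arcFrom_ne_botArc _ _ h).elim
  · exact (D.arcFrom_ne_botArc _ _ h.symm).elim
  · rw [D.botArc_injective h]

instance : Finite D.Arc := inferInstanceAs (Finite (Σ i : Fin k, Fin (D.size i + 1)))

end StringChordDiagram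

/-- An injective self-map of a finite type leads back along every path. -/
theorem exists_iterate_symm {α : Type*} [Finite α] {f : α → α} (hf : Function.Injective f)
    {a b : α} {m : ℕ} (h : f^[m] a = b) : ∃ l, f^[l] b = a := by
  obtain ⟨p, hp, hpa⟩ := hf.mem_periodicPts a
  -- Any `l` with `l + m` a multiple of the period `p` of `a` works; here `l + m = p * (m + 1)`.
  refine ⟨p * m - m + p * 1, ?_⟩
  rw [← h, ← Function.iterate_add_apply]
  have : p * m - m + p * 1 + m = p * (m + 1) := by
    have : m ≤ p * m := Nat.le_mul_of_pos_left m hp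
    rw [mul_add]; omega
  rw [this]
  exact hpa.mul_const _

/-- The classes of points joined by an injective self-map of a finite type are its orbits. -/
theorem exists_iterate_of_quot_mk_eq {α : Type*} [Finite α] {f : α → α}
    (hf : Function.Injective f) {a b : α}
    (h : Quot.mk (fun a b => f a = b) a = Quot.mk (fun a b => f a = b) b) :
    ∃ m, f^[m] a = b := by
  replace h := Quot.eqvGen_exact h
  induction h with
  | rel a b h => exact ⟨1, h⟩
  | refl a => exact ⟨0, rfl⟩
  | symm a b _ ih => exact exists_iterate_symm hf ih.choose_spec
  | trans a b c _ _ ih₁ ih₂ =>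
    obtain ⟨m, rfl⟩ := ih₁
    obtain ⟨l, rfl⟩ := ih₂
    exact ⟨l + m, Function.iterate_add_apply _ _ _ _⟩

namespace StringChordDiagram

variable {k n : ℕ} (D : StringChordDiagram k n)

theorem exists_iterate_next {T : Set (Fin n)} (h : D.numCircles T = 1) (a b : D.Arc) :
    ∃ m, (D.next T)^[m] a = b := by
  refine exists_iterate_of_quot_mk_eq (D.next_injective T) ?_
  have := (Nat.card_eq_one_iff_unique.1 h).1
  exact Subsingleton.elim _ _

/-- There is one circle exactly if the functions with values in `ℤ/2` that are constant along the
circles are constant. -/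
theorem numCircles_eq_one_iff [NeZero k] (T : Set (Fin n)) :
    D.numCircles T = 1 ↔
      ∀ φ : D.Arc → ZMod 2, (∀ a, φ (D.next T a) = φ a) → ∀ a b, φ a = φ b := by
  constructor
  · intro h φ hφ a b
    obtain ⟨m, rfl⟩ := D.exists_iterate_next h a b
    induction m with
    | zero => rfl
    | succ m ih => rw [ih, Function.iterate_succ_apply', hφ]
  · intro h
    refine Nat.card_eq_one_iff_unique.2 ⟨⟨fun p q => ?_⟩, ⟨Quot.mk _ (D.botArc 0)⟩⟩
    induction p using Quot.ind with | _ a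
    induction q using Quot.ind with | _ b
    classical
    -- The indicator of the circle of `b` is invariant and separates `b` from every other circle.
    have := h (fun c => if Quot.mk (fun a b => D.next T a = b) c = Quot.mk _ b then 1 else 0)
      (fun c => by rw [← Quot.sound (r := fun a b => D.next T a = b) (a := c) rfl]) a b
    by_contra hne
    simp [hne] at this

/-- Deleting the chords that are not surgered does not change the circles. -/
theorem numCircles_range {N : ℕ} (E : StringChordDiagram k N) (d : Fin n ↪ Fin N)
    (f : ∀ i, Fin (D.size i) → Fin (E.size i)) (hf : ∀ i, StrictMono (f i))
    (hd : ∀ j b, E.ends (d j, b) = ⟨(D.ends (j, b)).1, f _ (D.ends (j, b)).2⟩) :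
    E.numCircles (Set.range d) = D.numCircles Set.univ := by
  -- `cnt i j` counts the surviving endpoints below position `j`. So `g` sends an arc of `E` to the
  -- arc of `D` containing it, and `h` sends an arc of `D` to its topmost piece.
  let cnt (i : Fin k) (j : ℕ) : ℕ := (Finset.univ.filter fun t => (f i t : ℕ) < j).card
  have cnt_le (i j) : cnt i j < D.size i + 1 :=
    Nat.lt_succ_of_le ((Finset.card_le_univ _).trans_eq (Fintype.card_fin _))
  have cnt_f (i t) : cnt i (f i t) = t := by
    simp only [cnt, Fin.val_fin_lt, (hf i).lt_iff_lt]
    exact (congrArg _ (by ext; simp)).trans (Fin.card_Iio t)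
  have cnt_f_succ (i t) : cnt i (f i t + 1) = t + 1 := by
    simp only [cnt, Nat.lt_succ_iff, Fin.val_fin_le, (hf i).le_iff_le]
    exact (congrArg _ (by ext; simp)).trans (Fin.card_Iic t)
  have cnt_size (i) : cnt i (E.size i) = D.size i := by
    simp [cnt]
  have cnt_succ (i) (j : Fin (E.size i)) (hj : ∀ t, f i t ≠ j) : cnt i (j + 1) = cnt i j := by
    have this (t) : (f i t : ℕ) < j + 1 ↔ (f i t : ℕ) < j := by
      have : (f i t : ℕ) ≠ j := fun h => hj t (Fin.ext h)
      omega
    simp only [cnt, this]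
  let g (a : E.Arc) : D.Arc := toLex ⟨(ofLex a).1, ⟨cnt _ (ofLex a).2, cnt_le _ _⟩⟩
  let h (a : D.Arc) : E.Arc :=
    toLex ⟨(ofLex a).1, Fin.lastCases (Fin.last _) (fun t => (f _ t).castSucc) (ofLex a).2⟩
  have h_top (i) : h (D.topArc i) = E.topArc i := by simp [h, topArc]
  have h_arcTo (j b) : h (D.arcTo (D.ends (j, b))) = E.arcTo (E.ends (d j, b)) := by
    rw [hd]
    simp [h, arcTo]
  have g_top (i) : g (E.topArc i) = D.topArc i :=
    congrArg (fun t => toLex (Sigma.mk i t)) (Fin.ext (cnt_size i))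
  have g_bot (i) : g (E.botArc i) = D.botArc i := by
    simp [g, botArc, cnt]
  have g_arcTo (j b) : g (E.arcTo (E.ends (d j, b))) = D.arcTo (D.ends (j, b)) := by
    rw [hd]
    simp [g, arcTo, cnt_f, Fin.ext_iff]
  have g_arcFrom (j b) : g (E.arcFrom (E.ends (d j, b))) = D.arcFrom (D.ends (j, b)) := by
    rw [hd]
    simp [g, arcFrom, cnt_f_succ, Fin.ext_iff]
  have g_skip (x) (hx : x.1 ∉ Set.range d) :
      g (E.arcFrom (E.ends x)) = g (E.arcTo (E.ends x)) := by
    have := cnt_succ (E.ends x).1 (E.ends x).2 (fun t ht => hx ?_)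
    · simp [g, arcFrom, arcTo, this]
    · obtain ⟨⟨j, b⟩, hjb⟩ := D.ends.surjective ⟨_, t⟩
      have h1 := hd j b
      rw [hjb] at h1
      simp only [ht] at h1
      exact ⟨j, by rw [← E.ends.injective h1]⟩
  have jump_d (j b) : jump (Set.range d) (d j, b) = (d j, !b) := by simp [jump]
  have jump_D (j b) : jump (Set.univ) ((j, b) : Fin n × Bool) = (j, !b) := by simp [jump]
  have g_next (a) : g (E.next (Set.range d) (h a)) = D.next Set.univ a := by
    obtain ⟨⟨j, b⟩, rfl⟩ | ⟨i, rfl⟩ := D.arcTo_or_topArc a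
    · rw [h_arcTo, next_arcTo, next_arcTo, jump_d, jump_D, g_arcFrom]
    · rw [h_top, next_topArc, next_topArc, g_bot]
  -- At an unsurgered endpoint the walk goes straight on, so each piece lies on the same circle as
  -- the topmost piece; hence the induction from the top down.
  have mk_h (a : E.Arc) : Quot.mk (fun a b => E.next (Set.range d) a = b) (h (g a)) =
      Quot.mk _ a := by
    obtain ⟨i, j⟩ := a
    induction j using Fin.reverseInduction with
    | last => exact congrArg _ ((congrArg h (g_top i)).trans (h_top i))
    | cast t ih =>
      obtain ⟨⟨c, b⟩, hx⟩ := E.ends.surjective ⟨i, t⟩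
      have h1 : (⟨i, t.castSucc⟩ : Σ i : Fin k, Fin (E.size i + 1)) =
        E.arcTo (E.ends (c, b)) := by rw [hx]; rfl
      have h2 : (⟨i, t.succ⟩ : Σ i : Fin k, Fin (E.size i + 1)) =
        E.arcFrom (E.ends (c, b)) := by rw [hx]; rfl
      rw [h2] at ih
      rw [h1]
      by_cases hc : c ∈ Set.range d
      · obtain ⟨j, rfl⟩ := hc
        rw [g_arcTo, h_arcTo]
      · rw [g_skip (c, b) hc] at ih
        rw [ih]
        refine (Quot.sound ?_).symm
        rw [next_arcTo]
        simp [jump, hc]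
  refine Nat.card_congr ⟨Quot.lift (fun a => Quot.mk _ (g a)) ?_,
    Quot.lift (fun a => Quot.mk _ (h a)) ?_, ?_, ?_⟩
  · rintro a _ rfl
    obtain ⟨⟨c, b⟩, rfl⟩ | ⟨i, rfl⟩ := E.arcTo_or_topArc a
    · by_cases hc : c ∈ Set.range d
      · obtain ⟨j, rfl⟩ := hc
        refine Quot.sound ?_
        rw [g_arcTo, ← h_arcTo, g_next]
      · rw [next_arcTo]
        simp only [jump, hc, if_false]
        rw [g_skip (c, b) hc]
    · refine Quot.sound ?_
      rw [next_topArc, g_top, next_topArc, g_bot]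
  · rintro a _ rfl
    rw [← g_next, mk_h]
    exact Quot.sound rfl
  · intro q
    induction q using Quot.ind with | _ a
    exact mk_h a
  · intro q
    induction q using Quot.ind with | _ a
    have : g (h a) = a := by
      obtain ⟨⟨j, b⟩, rfl⟩ | ⟨i, rfl⟩ := D.arcTo_or_topArc a
      · rw [h_arcTo, g_arcTo]
      · rw [h_top, g_top]
    exact congrArg _ this

end StringChordDiagram

/-! ### Alternating and bordered matrices over `ℤ/2` -/

namespace Matrix

/-- An alternating matrix of odd size over `ℤ/2` is singular. -/
theorem det_eq_zero_of_odd_of_alternating {ι : Type*} [Fintype ι] [DecidableEq ι]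
    (hι : Odd (Fintype.card ι)) (A : Matrix ι ι (ZMod 2)) (hA : A.IsSymm)
    (hd : ∀ i, A i i = 0) : A.det = 0 := by
  let e := Fintype.equivFin ι
  -- In characteristic 2, `det = -det` says nothing, so the matrix is lifted to a skew-symmetric
  -- integer matrix.
  let B : Matrix ι ι ℤ := of fun i j =>
    if e i < e j then ((A i j).val : ℤ) else if e j < e i then -((A j i).val : ℤ) else 0
  have hB : Bᵀ = -B := by
    ext i j
    rcases lt_trichotomy (e i) (e j) with h | h | h <;> simp [B, h, not_lt_of_gt]
  have hdet : B.det = 0 := by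
    have h1 := B.det_transpose
    rw [hB, det_neg, hι.neg_one_pow] at h1
    linarith
  have hmap : B.map (Int.castRingHom (ZMod 2)) = A := by
    ext i j
    rcases lt_trichotomy (e i) (e j) with h | h | h
    · simp [B, h]
    · obtain rfl := e.injective h
      simp [B, hd]
    · simp [B, h, not_lt_of_gt h, hA.apply i j]
  rw [← hmap, ← RingHom.mapMatrix_apply, ← RingHom.map_det, hdet, map_zero]

/-- The quadratic form of a symmetric matrix over `ℤ/2` is linear, given by the diagonal. -/
theorem dotProduct_mulVec_self_of_isSymm {ι : Type*} [Fintype ι] [DecidableEq ι]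
    (A : Matrix ι ι (ZMod 2)) (hA : A.IsSymm) (x : ι → ZMod 2) :
    x ⬝ᵥ A *ᵥ x = A.diag ⬝ᵥ x := by
  have h0 : x ⬝ᵥ A *ᵥ x = ∑ p ∈ Finset.univ ×ˢ Finset.univ, x p.1 * A p.1 p.2 * x p.2 := by
    rw [Finset.sum_product]
    simp [dotProduct, mulVec, Finset.mul_sum, mul_assoc]
  -- Off-diagonal terms cancel in pairs under transposition; on the diagonal, `a * a = a`.
  rw [h0, ← Finset.diag_union_offDiag, Finset.sum_union (Finset.disjoint_diag_offDiag _),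
    Finset.sum_diag, Finset.sum_involution (s := Finset.offDiag _) (fun p _ => p.swap), add_zero]
  · refine Finset.sum_congr rfl fun i _ => ?_
    have : ∀ a b : ZMod 2, a * b * a = b * a := by decide
    exact this _ _
  · intro p _
    have : x p.2 * A p.2 p.1 * x p.1 = x p.1 * A p.1 p.2 * x p.2 := by
      rw [hA.apply p.1 p.2]; ring
    simp only [Prod.fst_swap, Prod.snd_swap, this]
    exact CharTwo.add_self_eq_zero _
  · rintro p hp _ h
    have := congrArg Prod.fst h
    simp at hp
    exact hp (this.symm)
  · intro p hp
    simpa [eq_comm] using hp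
  · intro p _
    simp

/-- A symmetric matrix over `ℤ/2` of odd size is nonsingular exactly if it is so after bordering it
with its diagonal; in even size, the bordered matrix is singular. -/
theorem bordered_diag_injective_iff {n : ℕ} (A : Matrix (Fin n) (Fin n) (ZMod 2))
    (hA : A.IsSymm) :
    (∀ (x : Fin n → ZMod 2) (c : ZMod 2), A *ᵥ x = c • A.diag → A.diag ⬝ᵥ x = 0 →
      x = 0 ∧ c = 0) ↔ A.det ≠ 0 ∧ Odd n := by
  set d := A.diag with hd
  have sq : ∀ a : ZMod 2, a + a * a = 0 := by decide
  have one : ∀ a : ZMod 2, a = 0 ∨ a = 1 := by decide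
  have B_symm : (A + vecMulVec d d).IsSymm := by
    ext i j
    simp [vecMulVec_apply, hA.apply i j, mul_comm]
  have B_diag (i) : (A + vecMulVec d d) i i = 0 := by
    simp [vecMulVec_apply, d, sq]
  have B_mulVec (x) : (A + vecMulVec d d) *ᵥ x = A *ᵥ x + (d ⬝ᵥ x) • d := by
    rw [add_mulVec, vecMulVec_mulVec]
    simp
  constructor
  · intro h
    constructor
    · intro hdet
      obtain ⟨x, hx, hAx⟩ := exists_mulVec_eq_zero_iff.2 hdet
      -- On the kernel of `A` the border equation is automatic, because `d · x = xᵀ A x`.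
      refine hx (h x 0 (by simp [hAx]) ?_).1
      rw [← dotProduct_mulVec_self_of_isSymm A hA, hAx, dotProduct_zero]
    · by_contra hn
      rw [Nat.not_odd_iff_even] at hn
      -- Adding `d` times the last row turns the bordered `A` into `P`, which has the same kernel
      -- and is alternating of odd size `n + 1`.
      let P : Matrix (Fin n ⊕ Unit) (Fin n ⊕ Unit) (ZMod 2) :=
        fromBlocks (A + vecMulVec d d) (replicateCol Unit d) (replicateRow Unit d) 0
      have hP : P.det = 0 := by
        refine det_eq_zero_of_odd_of_alternating (by simpa using hn.add_one) _ ?_ ?_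
        · refine IsSymm.fromBlocks B_symm ?_ rfl
          ext; simp
        · rintro (i | i)
          · exact B_diag i
          · rfl
      obtain ⟨y, hy, hPy⟩ := exists_mulVec_eq_zero_iff.2 hP
      have h1 := congrArg (fun v => v ∘ Sum.inl) hPy
      have h2 := congrFun hPy (Sum.inr ())
      simp only [P, fromBlocks_mulVec, Sum.elim_comp_inl, B_mulVec] at h1
      simp only [P, fromBlocks_mulVec, Sum.elim_inr] at h2
      have h2' : d ⬝ᵥ (y ∘ Sum.inl) = 0 := by simpa [mulVec] using h2
      rw [h2', zero_smul, add_zero] at h1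
      have h1' : A *ᵥ (y ∘ Sum.inl) = y (Sum.inr ()) • d := by
        ext i
        have := congrFun h1 i
        simp [mulVec, dotProduct] at this
        rw [CharTwo.add_eq_zero] at this
        simpa [mulVec, dotProduct, mul_comm] using this
      obtain ⟨hx, hc⟩ := h _ _ h1' h2'
      apply hy
      ext (i | i)
      · exact congrFun hx i
      · exact hc
  · rintro ⟨hdet, hn⟩ x c h1 h2
    have inj (y) (hy : A *ᵥ y = 0) : y = 0 := by
      by_contra hne
      exact hdet (exists_mulVec_eq_zero_iff.1 ⟨y, hne, hy⟩)
    obtain rfl | rfl := one c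
    · exact ⟨inj x (by simpa using h1), rfl⟩
    · exfalso
      -- A nonzero `y` satisfies `A y = (d · y) d`. Nonsingularity forces `d · y = 1`, then `A y = d
      -- = A x` gives `y = x`, against `d · x = 0`.
      obtain ⟨y, hy, hBy⟩ := exists_mulVec_eq_zero_iff.2
        (det_eq_zero_of_odd_of_alternating (by simpa using hn) _ B_symm B_diag)
      rw [B_mulVec] at hBy
      obtain h | h := one (d ⬝ᵥ y)
      · exact hy (inj y (by simpa [h] using hBy))
      · have : y + x = 0 := inj _ (by rw [mulVec_add, h1]; simpa [h] using hBy)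
        have : d ⬝ᵥ (y + x) = 0 := by rw [this, dotProduct_zero]
        rw [dotProduct_add, h, h2] at this
        simp at this

end Matrix

/-! ### Potentials on the arcs and the adjacency matrix -/

namespace StringChordDiagram

variable {k n : ℕ} (D : StringChordDiagram k n)

theorem eq_of_comp_eq_of_height_eq {x y : Fin n × Bool} (hc : D.comp x = D.comp y)
    (hh : D.height x = D.height y) : x = y := by
  apply D.ends.injective
  refine Sigma.ext hc ?_
  refine (Fin.heq_ext_iff ?_).2 hh
  exact congrArg D.size hc

open Classical in
/-- The indicator in `ℤ/2` of an endpoint lying below another one. -/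
noncomputable def below (x y : Fin n × Bool) : ZMod 2 :=
  if D.comp x = D.comp y ∧ D.height x < D.height y then 1 else 0

theorem below_add_below {x y : Fin n × Bool} (h : x ≠ y) :
    D.below x y + D.below y x = if D.comp x = D.comp y then 1 else 0 := by
  by_cases hc : D.comp x = D.comp y
  · rcases lt_trichotomy (D.height x) (D.height y) with hh | hh | hh
    · simp [below, hc, hh, hh.le]
    · exact (h (D.eq_of_comp_eq_of_height_eq hc hh)).elim
    · simp [below, hc, hh, hh.le]
  · simp [below, hc, Ne.symm hc]

theorem below_self (x : Fin n × Bool) : D.below x x = 0 := by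
  simp [below]

theorem edgeCount_cast (v w : Fin n) :
    (D.edgeCount v w : ZMod 2) = ∑ b, ∑ b', D.below (v, b) (w, b') := by
  rw [← Fintype.sum_prod_type' (f := fun b b' => D.below (v, b) (w, b'))]
  simp [edgeCount, below, Finset.sum_boole]

open Classical in
/-- The indicator in `ℤ/2` of a chord that joins different components. -/
noncomputable def mixed (v : Fin n) : ZMod 2 :=
  if D.comp (v, false) = D.comp (v, true) then 0 else 1

theorem adj_diag (v : Fin n) : D.intersectionGraph.adj v v = D.mixed v := by
  simp [LabeledDigraph.adj, intersectionGraph, mixed]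

/-- For `v = w` the count is odd exactly when both endpoints share a component, the opposite of the
diagonal convention; hence the correction term. -/
theorem edgeCount_cast_eq_adj (v w : Fin n) :
    (D.edgeCount v w : ZMod 2) = D.intersectionGraph.adj v w + if v = w then 1 else 0 := by
  by_cases h : v = w
  · subst h
    have := D.below_add_below (x := (v, false)) (y := (v, true)) (by simp)
    rw [adj_diag, edgeCount_cast]
    simp only [Fintype.sum_bool, below_self, zero_add, add_zero, if_true]
    rw [add_comm, this, mixed]
    split_ifs <;> decide
  · simp only [LabeledDigraph.adj, intersectionGraph, Matrix.of_apply, h, if_false, ne_eq,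
      not_false_eq_true, true_and, add_zero]
    split_ifs with ho
    · exact (ZMod.natCast_eq_one_iff_odd).2 ho
    · exact (ZMod.natCast_eq_zero_iff_even).2 (Nat.not_odd_iff_even.1 ho)

section TwoComponents

open Matrix

variable {n : ℕ} (D : StringChordDiagram 2 n)

/-- The counts for `(v, w)` and `(w, v)` add up to the number of endpoint pairs on a common
component, which is even when there are only two components. -/
theorem adj_isSymm : D.intersectionGraph.adj.IsSymm := by
  ext v w
  rw [Matrix.transpose_apply]
  by_cases h : v = w
  · rw [h]
  · have h1 := D.edgeCount_cast_eq_adj v w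
    have h2 := D.edgeCount_cast_eq_adj w v
    rw [if_neg h, add_zero] at h1
    rw [if_neg (Ne.symm h), add_zero] at h2
    rw [← h1, ← h2, ← CharTwo.add_eq_zero, edgeCount_cast, edgeCount_cast]
    have key (b b' : Bool) := D.below_add_below (x := (v, b)) (y := (w, b')) (by simp [h])
    have par : ∀ i i' j j' : Fin 2, ((if i = j then 1 else 0) + (if i = j' then 1 else 0) +
      (if i' = j then 1 else 0) + (if i' = j' then 1 else 0) : ZMod 2) = 0 := by decide
    have := par (D.comp (v, false)) (D.comp (v, true)) (D.comp (w, false)) (D.comp (w, true))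
    rw [← key, ← key, ← key, ← key] at this
    simp only [Fintype.sum_bool]
    linear_combination this

/-- The function on arcs with the values `c` at the bottoms of the components that jumps by `x v`
at the endpoints of the chord `v`. -/
noncomputable def potential (x : Fin n → ZMod 2) (c : Fin 2 → ZMod 2) (a : D.Arc) : ZMod 2 :=
  c (ofLex a).1 + ∑ y : Fin n × Bool,
    if D.comp y = (ofLex a).1 ∧ D.height y < (ofLex a).2 then x y.1 else 0

variable (x : Fin n → ZMod 2) (c : Fin 2 → ZMod 2)

theorem potential_arcTo (z : Fin n × Bool) :
    D.potential x c (D.arcTo (D.ends z)) = c (D.comp z) + ∑ y, x y.1 * D.below y z := by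
  refine congrArg _ (Finset.sum_congr rfl fun y _ => ?_)
  rw [below, mul_ite, mul_one, mul_zero]
  exact if_congr Iff.rfl rfl rfl

theorem potential_arcFrom (z : Fin n × Bool) :
    D.potential x c (D.arcFrom (D.ends z)) = D.potential x c (D.arcTo (D.ends z)) + x z.1 := by
  have h1 : x z.1 = ∑ y : Fin n × Bool, if y = z then x y.1 else 0 := by simp
  rw [h1]
  simp only [potential, arcFrom, arcTo, ofLex_toLex, Fin.val_succ, Fin.val_castSucc]
  rw [add_assoc, ← Finset.sum_add_distrib]
  congr 1
  refine Finset.sum_congr rfl fun y _ => ?_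
  by_cases hy : y = z
  · subst hy
    simp [comp, height]
  · have : D.comp y = (D.ends z).1 → D.height y ≠ ((D.ends z).2 : ℕ) :=
      fun h1 h2 => hy (D.eq_of_comp_eq_of_height_eq h1 h2)
    have h3 : (D.comp y = (D.ends z).1 ∧ D.height y < ((D.ends z).2 : ℕ) + 1) ↔
        (D.comp y = (D.ends z).1 ∧ D.height y < ((D.ends z).2 : ℕ)) := by
      refine and_congr_right fun h => ?_
      have := this h
      omega
    rw [if_neg hy, add_zero]
    exact if_congr h3 rfl rfl

theorem potential_botArc (i : Fin 2) : D.potential x c (D.botArc i) = c i := by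
  simp [potential, botArc]

/-- With two components, a mixed chord has exactly one endpoint on each, and the two jumps of any
other chord cancel. So both components give the same closing condition. -/
theorem potential_topArc (i : Fin 2) :
    D.potential x c (D.topArc i) = c i + D.intersectionGraph.adj.diag ⬝ᵥ x := by
  have h1 (y : Fin n × Bool) : (D.comp y = i ∧ D.height y < D.size i) ↔ D.comp y = i :=
    ⟨And.left, fun h => ⟨h, by subst h; exact (D.ends y).2.isLt⟩⟩
  simp only [potential, topArc, ofLex_toLex, Fin.val_last, h1, Fintype.sum_prod_type,
    Fintype.sum_bool, dotProduct, Matrix.diag_apply, adj_diag]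
  congr 1
  refine Finset.sum_congr rfl fun v _ => ?_
  have par : ∀ (i j j' : Fin 2) (a : ZMod 2), (if j' = i then a else 0) + (if j = i then a else 0) =
      (if j = j' then 0 else 1) * a := by decide
  simpa [mixed] using par i (D.comp (v, false)) (D.comp (v, true)) (x v)

/-- The summand `x v` comes from the diagonal correction in `edgeCount_cast_eq_adj`; it cancels the
jump at `v` when invariance is imposed. -/
theorem potential_arcTo_add (v : Fin n) :
    D.potential x c (D.arcTo (D.ends (v, false))) + D.potential x c (D.arcTo (D.ends (v, true))) =
      (D.intersectionGraph.adj *ᵥ x) v + (c 0 + c 1) * D.intersectionGraph.adj.diag v + x v := by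
  have h1 : ∑ y : Fin n × Bool, x y.1 * D.below y (v, false) +
      ∑ y : Fin n × Bool, x y.1 * D.below y (v, true) =
      (D.intersectionGraph.adj *ᵥ x) v + x v := by
    have h2 : x v = ∑ w, x w * (if w = v then 1 else 0) := by simp
    rw [h2]
    simp only [Matrix.mulVec, dotProduct, Fintype.sum_prod_type, ← Finset.sum_add_distrib]
    refine Finset.sum_congr rfl fun w _ => ?_
    have h3 := D.edgeCount_cast_eq_adj w v
    rw [edgeCount_cast] at h3
    simp only [Fintype.sum_bool] at h3 ⊢
    rw [D.adj_isSymm.apply w v]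
    linear_combination x w * h3
  have h4 : c (D.comp (v, false)) + c (D.comp (v, true)) =
      (c 0 + c 1) * D.intersectionGraph.adj.diag v := by
    rw [Matrix.diag_apply, adj_diag, mixed]
    generalize D.comp (v, false) = i
    generalize D.comp (v, true) = j
    fin_cases i <;> fin_cases j <;>
      simp [CharTwo.add_self_eq_zero, add_comm]
  rw [potential_arcTo, potential_arcTo]
  linear_combination h1 + h4

/-- A potential is constant along the circles exactly if it satisfies the equations of the bordered
adjacency matrix. -/
theorem potential_next_iff :
    (∀ a, D.potential x c (D.next Set.univ a) = D.potential x c a) ↔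
      D.intersectionGraph.adj *ᵥ x = (c 0 + c 1) • D.intersectionGraph.adj.diag ∧
        D.intersectionGraph.adj.diag ⬝ᵥ x = 0 := by
  have jmp (v b) : jump Set.univ ((v, b) : Fin n × Bool) = (v, !b) := by simp [jump]
  have alg : ∀ p q r s t : ZMod 2, p + q = r + s + t → (q + t = p ↔ r = s) := by decide
  constructor
  · intro h
    constructor
    · ext v
      have h1 := h (D.arcTo (D.ends (v, false)))
      rw [next_arcTo, jmp, Bool.not_false, potential_arcFrom] at h1
      exact (alg _ _ _ _ _ (D.potential_arcTo_add x c v)).1 h1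
    · have h1 := h (D.topArc 0)
      rw [next_topArc, potential_topArc, potential_botArc] at h1
      simpa using h1
  · rintro ⟨h1, h2⟩ a
    obtain ⟨⟨v, b⟩, rfl⟩ | ⟨i, rfl⟩ := D.arcTo_or_topArc a
    · have h3 := D.potential_arcTo_add x c v
      rw [next_arcTo, jmp, potential_arcFrom]
      cases b
      · exact (alg _ _ _ _ _ h3).2 (congrFun h1 v)
      · rw [add_comm] at h3
        exact (alg _ _ _ _ _ h3).2 (congrFun h1 v)
    · rw [next_topArc, potential_topArc, potential_botArc, h2, add_zero]

/-- Invariance equates the value just after one end of a chord with the value just before the other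
end, so the jump at either end is the sum of the two values before the ends. -/
theorem eq_potential_of_next (φ : D.Arc → ZMod 2) (hφ : ∀ a, φ (D.next Set.univ a) = φ a) :
    φ = D.potential (fun v => φ (D.arcTo (D.ends (v, false))) + φ (D.arcTo (D.ends (v, true))))
      (fun i => φ (D.botArc i)) := by
  set x : Fin n → ZMod 2 :=
    fun v => φ (D.arcTo (D.ends (v, false))) + φ (D.arcTo (D.ends (v, true))) with hx
  have step (z : Fin n × Bool) :
      φ (D.arcFrom (D.ends z)) = φ (D.arcTo (D.ends z)) + x z.1 := by
    obtain ⟨v, b⟩ := z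
    have h1 := hφ (D.arcTo (D.ends (v, !b)))
    rw [next_arcTo] at h1
    simp only [jump, Set.mem_univ, if_true, Bool.not_not] at h1
    rw [h1, hx]
    cases b
    · simp [← add_assoc, CharTwo.add_self_eq_zero]
    · rw [add_left_comm, CharTwo.add_self_eq_zero, add_zero, Bool.not_true]
  ext a
  obtain ⟨i, j⟩ := a
  induction j using Fin.induction with
  | zero => exact (D.potential_botArc x (fun i => φ (D.botArc i)) i).symm
  | succ t ih =>
    obtain ⟨z, hz⟩ := D.ends.surjective ⟨i, t⟩
    have h1 := step z
    have h2 := D.potential_arcFrom x (fun i => φ (D.botArc i)) z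
    rw [hz] at h1 h2
    exact h1.trans ((congrArg (· + x z.1) ih).trans h2.symm)

/-- Surgery on all chords yields one circle exactly if the adjacency matrix is nonsingular and the
number of chords is odd. -/
theorem numCircles_univ_eq_one_iff :
    D.numCircles Set.univ = 1 ↔ D.intersectionGraph.adj.det ≠ 0 ∧ Odd n := by
  rw [← Matrix.bordered_diag_injective_iff _ D.adj_isSymm, numCircles_eq_one_iff]
  constructor
  · intro h x c h1 h2
    -- Only `c 0 + c 1` enters the equations, so the bottom values `c` and `0` realize any given
    -- `c`.
    have hc := h (D.potential x ![c, 0]) ((D.potential_next_iff _ _).2 ⟨by simpa using h1, h2⟩)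
    constructor
    · ext v
      have h3 := D.potential_arcFrom x ![c, 0] (v, false)
      rw [hc _ (D.arcTo (D.ends (v, false)))] at h3
      simpa using h3
    · simpa [potential_botArc] using hc (D.botArc 0) (D.botArc 1)
  · intro h φ hφ
    have h1 := D.eq_potential_of_next φ hφ
    generalize (fun v => φ (D.arcTo (D.ends (v, false))) + φ (D.arcTo (D.ends (v, true)))) = x at h1
    generalize (fun i => φ (D.botArc i)) = c at h1
    subst h1
    obtain ⟨h2, h3⟩ := (D.potential_next_iff x c).1 hφ
    obtain ⟨rfl, h4⟩ := h x _ h2 h3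
    rw [CharTwo.add_eq_zero] at h4
    have h5 (i) : c i = c 0 := by fin_cases i <;> simp [h4]
    intro a b
    simp [potential, h5 (ofLex a).1, h5 (ofLex b).1]

theorem conwayWeight_eq :
    D.conwayWeight =
      ((D.intersectionGraph.adj.det * (D.intersectionGraph.adj.rank : ZMod 2)).val : ℤ) := by
  rw [conwayWeight]
  simp only [numCircles_univ_eq_one_iff]
  by_cases h : D.intersectionGraph.adj.det = 0
  · simp [h]
  · have one : ∀ a : ZMod 2, a ≠ 0 → a = 1 := by decide
    have hr : D.intersectionGraph.adj.rank = n := by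
      rw [Matrix.rank_of_isUnit _ ((Matrix.isUnit_iff_isUnit_det _).2 (isUnit_iff_ne_zero.2 h)),
        Fintype.card_fin]
    rw [hr, one _ h, one_mul]
    by_cases hn : Odd n
    · simp [hn, (ZMod.natCast_eq_one_iff_odd).2 hn, ZMod.val_one]
    · simp [hn, (ZMod.natCast_eq_zero_iff_even).2 (Nat.not_odd_iff_even.1 hn)]

end TwoComponents

end StringChordDiagram

/-! ### Order of passage and existence of skein computations -/

namespace StringChordDiagram

variable {k n : ℕ} (D : StringChordDiagram k n)

theorem botArc_zero_le [NeZero k] (a : D.Arc) : D.botArc 0 ≤ a := by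
  obtain ⟨i, j⟩ := a
  refine Sigma.Lex.le_def.2 ?_
  rcases (Fin.zero_le i).lt_or_eq with h | h
  · exact .inl h
  · subst h
    exact .inr ⟨rfl, Fin.zero_le _⟩

theorem arcTo_ends_ne {x y : Fin n × Bool} (h : x ≠ y) :
    D.arcTo (D.ends x) ≠ D.arcTo (D.ends y) :=
  fun h' => h (D.ends.injective (D.arcTo_injective h'))

/-- Walking from the bottom of the first component, with the chords in `T` surgered, one meets the
endpoint `x` before the other endpoint of the same chord. -/
def MetFirst [NeZero k] (T : Set (Fin n)) (x : Fin n × Bool) : Prop :=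
  ∃ m, (D.next T)^[m] (D.botArc 0) = D.arcTo (D.ends x) ∧
    ∀ l ≤ m, (D.next T)^[l] (D.botArc 0) ≠ D.arcTo (D.ends (x.1, !x.2))

/-- Of two events that happen at different times, exactly one happens first. -/
theorem happens_first_iff_not {P Q : ℕ → Prop} (hP : ∃ m, P m) (hQ : ∃ m, Q m)
    (hPQ : ∀ m, P m → ¬ Q m) :
    (∃ m, Q m ∧ ∀ l ≤ m, ¬ P l) ↔ ¬ ∃ m, P m ∧ ∀ l ≤ m, ¬ Q l := by
  classical
  constructor
  · rintro ⟨m, hm, hm'⟩ ⟨l, hl, hl'⟩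
    rcases le_total l m with h | h
    · exact hm' l h hl
    · exact hl' m h hm
  · intro h
    refine ⟨Nat.find hQ, Nat.find_spec hQ, fun l hl hPl => h ?_⟩
    refine ⟨Nat.find hP, Nat.find_spec hP, fun l' hl' hQl' => ?_⟩
    have h1 : Nat.find hP ≤ l := Nat.find_min' hP hPl
    have h2 : Nat.find hQ ≤ l' := Nat.find_min' hQ hQl'
    exact hPQ _ (Nat.find_spec hP) (by convert Nat.find_spec hQ using 1; omega)

theorem metFirst_not_iff [NeZero k] {T : Set (Fin n)} (hT : D.numCircles T = 1)
    (c : Fin n) (b : Bool) : D.MetFirst T (c, !b) ↔ ¬ D.MetFirst T (c, b) := by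
  simp only [MetFirst, Bool.not_not]
  refine happens_first_iff_not (D.exists_iterate_next hT _ _) (D.exists_iterate_next hT _ _) ?_
  intro m h1 h2
  exact D.arcTo_ends_ne (by simp) (h1.symm.trans h2)

end StringChordDiagram

namespace FlatStringDiagram

variable {k N : ℕ} (E : FlatStringDiagram k N)

theorem exists_visited (s : Fin N → CrossingState) (a : E.Arc) : ∃ b m, E.Visited s a b m := by
  classical
  obtain ⟨b, ⟨l, hl⟩, hb⟩ := WellFounded.has_min (wellFounded_lt (α := E.Arc))
    (Set.range fun l => (E.next (smoothed s))^[l] a) ⟨a, 0, rfl⟩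
  have hex := exists_iterate_symm (E.next_injective (smoothed s)) hl
  refine ⟨b, Nat.find hex, fun l' => not_lt.1 (hb _ ⟨l' + l, ?_⟩), Nat.find_spec hex,
    fun l' hl' => Nat.find_min hex hl'⟩
  simp only [Function.iterate_add_apply] at hl ⊢
  rw [hl]

theorem before_or_before (s : Fin N → CrossingState) {a a' : E.Arc} (h : a ≠ a') :
    E.Before s a a' ∨ E.Before s a' a := by
  obtain ⟨b, m, hb⟩ := E.exists_visited s a
  obtain ⟨b', m', hb'⟩ := E.exists_visited s a'
  rcases lt_trichotomy b b' with h1 | rfl | h1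
  · exact .inl ⟨b, m, b', m', hb, hb', .inl h1⟩
  · rcases lt_trichotomy m m' with h2 | rfl | h2
    · exact .inl ⟨b, m, b, m', hb, hb', .inr ⟨rfl, h2⟩⟩
    · exact (h (hb.2.1.symm.trans hb'.2.1)).elim
    · exact .inr ⟨b, m', b, m, hb', hb, .inr ⟨rfl, h2⟩⟩
  · exact .inr ⟨b', m', b, m, hb', hb, .inl h1⟩

/-- The crossing `c` is passed first on the upper branch, if it is not smoothed. -/
def DescendingAt (s : Fin N → CrossingState) (c : Fin N) : Prop :=
  (s c = CrossingState.pos →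
    E.Before s (E.arcTo (E.ends (c, E.posOver c))) (E.arcTo (E.ends (c, !E.posOver c)))) ∧
  (s c = CrossingState.neg →
    E.Before s (E.arcTo (E.ends (c, !E.posOver c))) (E.arcTo (E.ends (c, E.posOver c))))

theorem before_congr {s s' : Fin N → CrossingState} (h : smoothed s = smoothed s') :
    E.Before s = E.Before s' := by
  simp only [funext_iff, Before, Visited, h, implies_true]

/-- Every diagram can be reduced to descending ones by the skein relation. -/
theorem exists_hasConway (s : Fin N → CrossingState) : ∃ p, E.HasConway s p := by
  classical
  -- Lexicographic induction: on the number of crossings, then on the number of those that violate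
  -- descent.
  induction hr : (Finset.univ.filter fun c => s c ≠ .smooth).card using Nat.strong_induction_on
    generalizing s with | _ r ihr
  subst hr
  induction hb : (Finset.univ.filter fun c => ¬ E.DescendingAt s c).card
    using Nat.strong_induction_on generalizing s with | _ r ihb
  subst hb
  by_cases hd : E.Descending s
  · exact ⟨_, .unlink s hd⟩
  obtain ⟨c, hc⟩ : ∃ c, ¬ E.DescendingAt s c := not_forall.1 hd
  have hns : s c ≠ .smooth := fun h => hc (by simp [DescendingAt, h])
  obtain ⟨q, hq⟩ := ihr _ (by
    refine Finset.card_lt_card (Finset.ssubset_iff_of_subset ?_ |>.2 ⟨c, by simpa, by simp⟩)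
    intro c' hc'
    by_cases h : c' = c
    · subst h; simp at hc'
    · simpa [h] using hc') (Function.update s c .smooth) rfl
  -- A crossing change leaves the walk unchanged, so it repairs `c` without affecting the other
  -- crossings.
  have switch (σ : CrossingState) (hσ : σ ≠ .smooth) (hσ' : σ ≠ s c) :
      ∃ p, E.HasConway (Function.update s c σ) p := by
    have hns' (c') : Function.update s c σ c' ≠ .smooth ↔ s c' ≠ .smooth := by
      by_cases h : c' = c
      · subst h; simp [hσ, hns]
      · simp [h]
    have hsm : smoothed (Function.update s c σ) = smoothed s := by
      ext c'
      exact not_iff_not.1 (hns' c')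
    have hbef := E.before_congr hsm
    refine ihb _ ?_ _ (fun r hr => ihr r (by simpa only [hns'] using hr)) rfl
    refine Finset.card_lt_card (Finset.ssubset_iff_of_subset ?_ |>.2 ⟨c, by simpa, ?_⟩)
    · intro c' hc'
      by_cases h : c' = c
      · subst h; simpa using hc
      · simpa [h, DescendingAt, hbef] using hc'
    · have htot := E.before_or_before s (E.arcTo_ends_ne
        (x := (c, E.posOver c)) (y := (c, !E.posOver c)) (by simp))
      simp only [DescendingAt, Finset.mem_filter, Finset.mem_univ, true_and, not_not,
        Function.update_self, hbef] at hc ⊢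
      cases σ <;> cases hsc : s c <;> simp_all
  cases hs : s c with
  | smooth => exact (hns hs).elim
  | pos =>
    obtain ⟨p, hp⟩ := switch .neg (by simp) (by simp [hs])
    exact ⟨_, .skeinPos s c p q hs hp hq⟩
  | neg =>
    obtain ⟨p, hp⟩ := switch .pos (by simp) (by simp [hs])
    exact ⟨_, .skeinNeg s c p q hs hp hq⟩

/-! ### The state sum -/

open Classical in
/-- The contribution of the point `c` in state `σ` to the state in which the points in `T` are
smoothed: a crossing may be smoothed at the cost of `X` or `-X` if it is first met on the lower
branch. -/
noncomputable def stateWeight [NeZero k] (T : Set (Fin N)) (c : Fin N) : CrossingState → ℤ[X]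
  | .pos => if c ∈ T then (if E.MetFirst T (c, !E.posOver c) then X else 0) else 1
  | .neg => if c ∈ T then (if E.MetFirst T (c, E.posOver c) then -X else 0) else 1
  | .smooth => if c ∈ T then 1 else 0

open Classical in
/-- The state sum for the Conway polynomial, over the states with one circle. -/
noncomputable def stateSum [NeZero k] (s : Fin N → CrossingState) : ℤ[X] :=
  ∑ T : Finset (Fin N), if E.numCircles T = 1 then ∏ c, E.stateWeight T c (s c) else 0

variable [NeZero k]

/-- If `c ∈ T`, exactly one branch is met first, so exactly one of the two signs contributes; if `c
∉ T`, both crossings weigh `1` and the smoothing `0`. -/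
theorem stateWeight_skein {T : Set (Fin N)} (hT : E.numCircles T = 1) (c : Fin N) :
    E.stateWeight T c .pos - E.stateWeight T c .neg = X * E.stateWeight T c .smooth := by
  by_cases hc : c ∈ T
  · by_cases h : E.MetFirst T (c, E.posOver c) <;>
      simp [stateWeight, hc, h, E.metFirst_not_iff hT]
  · simp [stateWeight, hc]

theorem stateSum_skein (s : Fin N → CrossingState) (c : Fin N) :
    E.stateSum (Function.update s c .pos) - E.stateSum (Function.update s c .neg) =
      X * E.stateSum (Function.update s c .smooth) := by
  simp only [stateSum, Finset.mul_sum, ← Finset.sum_sub_distrib]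
  refine Finset.sum_congr rfl fun T _ => ?_
  split_ifs with hT
  · have key (σ : CrossingState) : ∏ c', E.stateWeight T c' (Function.update s c σ c') =
        E.stateWeight T c σ * ∏ c' ∈ {c}ᶜ, E.stateWeight T c' (s c') := by
      rw [Fintype.prod_eq_mul_prod_compl c, Function.update_self]
      congr 1
      refine Finset.prod_congr rfl fun c' hc' => ?_
      rw [Function.update_of_ne (by simpa using hc')]
    rw [key, key, key, ← sub_mul, E.stateWeight_skein hT, mul_assoc]
  · simp

/-- At `X = 0` a crossing in `T` weighs `0`, so only the set of points already smoothed survives. -/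
theorem stateSum_coeff_zero (s : Fin N → CrossingState) :
    (E.stateSum s).coeff 0 = if E.numComponents s = 1 then 1 else 0 := by
  classical
  rw [coeff_zero_eq_eval_zero, stateSum, eval_finsetSum]
  have key (T : Finset (Fin N)) : ∏ c, (E.stateWeight T c (s c)).eval 0 =
      if T = (smoothed s).toFinset then 1 else 0 := by
    have h1 (c) : (E.stateWeight T c (s c)).eval 0 =
        if (c ∈ T ↔ c ∈ (smoothed s).toFinset) then 1 else 0 := by
      have h0 : c ∈ (smoothed s).toFinset ↔ s c = .smooth := by rw [Set.mem_toFinset]; rfl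
      simp only [h0]
      by_cases hc : c ∈ T <;> cases s c <;> simp [stateWeight, hc] <;> split_ifs <;> simp
    simp only [h1, Finset.prod_boole, Finset.mem_univ, true_imp_iff, Finset.ext_iff]
  have h2 (T : Finset (Fin N)) : eval 0 (if E.numCircles (T : Set (Fin N)) = 1 then
      ∏ c, E.stateWeight T c (s c) else 0) =
      if T = (smoothed s).toFinset then (if E.numComponents s = 1 then 1 else 0) else 0 := by
    rw [apply_ite (eval 0), eval_prod, key, eval_zero]
    by_cases hT : T = (smoothed s).toFinset
    · simp only [hT, if_true, Set.coe_toFinset, numComponents]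
      exact if_congr Iff.rfl rfl rfl
    · simp [hT]
  simp only [h2]
  simp

/-- The alternating sum of the state sums over the resolutions of some double points. -/
theorem sum_resolve_stateSum {n : ℕ} (d : Fin n ↪ Fin N) (sign : Fin N → Bool)
    (s : (Fin n → Bool) → Fin N → CrossingState)
    (hs : ∀ ε c, s ε c = if Function.extend d ε sign c then .pos else .neg)
    (s' : Fin N → CrossingState) (hs' : ∀ j, s' (d j) = .smooth)
    (hs'' : ∀ c ∉ Set.range d, s' c = if sign c then .pos else .neg) :
    ∑ ε : Fin n → Bool, (∏ j, if ε j then (1 : ℤ[X]) else -1) * E.stateSum (s ε) =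
      X ^ n * E.stateSum s' := by
  classical
  simp only [stateSum, Finset.mul_sum]
  rw [Finset.sum_comm]
  refine Finset.sum_congr rfl fun T _ => ?_
  split_ifs with hT
  · have split (f : Fin N → ℤ[X]) : ∏ c, f c =
        (∏ j, f (d j)) * ∏ c ∈ (Finset.univ.map d)ᶜ, f c := by
      rw [← Finset.prod_map, Finset.prod_mul_prod_compl]
    have h1 (ε : Fin n → Bool) :
        (∏ j, if ε j then (1 : ℤ[X]) else -1) * ∏ c, E.stateWeight T c (s ε c) =
        (∏ j, (if ε j then 1 else -1) * E.stateWeight T (d j) (if ε j then .pos else .neg)) *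
          ∏ c ∈ (Finset.univ.map d)ᶜ, E.stateWeight T c (s' c) := by
      rw [split, Finset.prod_mul_distrib, mul_assoc]
      congr 2
      · exact Finset.prod_congr rfl fun j _ => by rw [hs, d.injective.extend_apply]
      · refine Finset.prod_congr rfl fun c hc => ?_
        have hc' : c ∉ Set.range d := by simpa using hc
        rw [hs, hs'' c hc', Function.extend_apply' _ _ _ hc']
    -- For fixed `T` the sum over resolutions factors over the double points, and each factor is one
    -- skein difference.
    have h2 := Finset.prod_univ_sum (fun _ : Fin n => (Finset.univ : Finset Bool))
      (fun j b => (if b then (1 : ℤ[X]) else -1) * E.stateWeight T (d j) (if b then .pos else .neg))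
    rw [Fintype.piFinset_univ] at h2
    rw [Finset.sum_congr rfl fun ε _ => h1 ε, ← Finset.sum_mul, ← h2, split]
    simp only [Fintype.sum_bool, hs', if_true, Bool.false_eq_true, if_false, one_mul, neg_one_mul,
      ← sub_eq_add_neg, E.stateWeight_skein hT, Finset.prod_mul_distrib, Finset.prod_const,
      Finset.card_univ, Fintype.card_fin, mul_assoc]
  · simp

/-- A nonempty set of crossings of a descending diagram is met first on an upper branch. -/
theorem Descending.exists_stateWeight_eq_zero {s : Fin N → CrossingState} (hs : E.Descending s)
    {T : Set (Fin N)} (hT : E.numCircles T = 1) (hsub : smoothed s ⊆ T) (hne : T ≠ smoothed s) :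
    ∃ c, E.stateWeight T c (s c) = 0 := by
  classical
  obtain ⟨c₀, hc₀, hc₀'⟩ := Set.exists_of_ssubset (hsub.ssubset_of_ne hne.symm)
  have hex : ∃ m, ∃ c ∈ T, c ∉ smoothed s ∧ ∃ b,
      (E.next T)^[m] (E.botArc 0) = E.arcTo (E.ends (c, b)) := by
    obtain ⟨m, hm⟩ := E.exists_iterate_next hT (E.botArc 0) (E.arcTo (E.ends (c₀, true)))
    exact ⟨m, c₀, hc₀, hc₀', true, hm⟩
  -- `c` is the first crossing in `T` outside `smoothed s` to be reached; until then the walks for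
  -- `T` and for `smoothed s` agree.
  obtain ⟨m, ⟨c, hcT, hcs, b, hm⟩, hmin⟩ : ∃ m, (∃ c ∈ T, c ∉ smoothed s ∧ ∃ b,
      (E.next T)^[m] (E.botArc 0) = E.arcTo (E.ends (c, b))) ∧ ∀ l < m, ¬ ∃ c ∈ T,
      c ∉ smoothed s ∧ ∃ b, (E.next T)^[l] (E.botArc 0) = E.arcTo (E.ends (c, b)) :=
    ⟨Nat.find hex, Nat.find_spec hex, fun l hl => Nat.find_min hex hl⟩
  have agree (l) (hl : l ≤ m) :
      (E.next (smoothed s))^[l] (E.botArc 0) = (E.next T)^[l] (E.botArc 0) := by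
    induction l with
    | zero => rfl
    | succ l ih =>
      rw [Function.iterate_succ_apply', Function.iterate_succ_apply', ih (by omega)]
      obtain ⟨⟨c', b'⟩, h'⟩ | ⟨i, h'⟩ :=
        E.arcTo_or_topArc ((E.next T)^[l] (E.botArc 0))
      · rw [h', StringChordDiagram.next_arcTo, StringChordDiagram.next_arcTo]
        have : c' ∈ smoothed s ↔ c' ∈ T := by
          refine ⟨fun h => hsub h, fun h => ?_⟩
          by_contra h2
          exact hmin l (by omega) ⟨c', h, h2, b', h'⟩
        simp only [StringChordDiagram.jump, this]
      · rw [h', StringChordDiagram.next_topArc, StringChordDiagram.next_topArc]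
  have key (u : Bool) (hu : E.Before s (E.arcTo (E.ends (c, u))) (E.arcTo (E.ends (c, !u)))) :
      ¬ E.MetFirst T (c, !u) := by
    rintro ⟨m', hm', hm''⟩
    simp only [Bool.not_not] at hm''
    have hle : m ≤ m' := by
      by_contra hlt
      exact hmin m' (by omega) ⟨c, hcT, hcs, _, hm'⟩
    by_cases hb : b = u
    · subst hb
      exact hm'' m hle hm
    -- If `c` were reached first on its lower branch, descent would put the upper branch earlier on
    -- the same walk, against the minimality of `m`.
    · obtain rfl : b = !u := by cases b <;> cases u <;> simp_all
      obtain ⟨a₁, m₁, a₂, m₂, ⟨-, h1, -⟩, ⟨h2, h3, h4⟩, h5⟩ := hu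
      obtain ⟨l, hl⟩ := exists_iterate_symm (E.next_injective (smoothed s))
        ((agree m le_rfl).trans hm)
      have ha₂ : a₂ = E.botArc 0 := by
        refine le_antisymm ?_ (E.botArc_zero_le _)
        have := h2 (l + m₂)
        rwa [Function.iterate_add_apply, h3, hl] at this
      subst ha₂
      obtain h5 | ⟨rfl, h5⟩ := h5
      · exact h5.not_ge (E.botArc_zero_le _)
      · have hle2 : m₂ ≤ m := by
          by_contra hlt
          exact h4 m (by omega) ((agree m le_rfl).trans hm)
        exact hmin m₁ (by omega) ⟨c, hcT, hcs, u, (agree m₁ (by omega)).symm.trans h1⟩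
  refine ⟨c, ?_⟩
  cases hc : s c with
  | smooth => exact (hcs hc).elim
  | pos => simp [stateWeight, key _ ((hs c).1 hc), hcT]
  | neg =>
    have := key (!E.posOver c) (by simpa using (hs c).2 hc)
    rw [Bool.not_not] at this
    simp [stateWeight, this, hcT]

theorem stateSum_of_descending {s : Fin N → CrossingState} (hs : E.Descending s) :
    E.stateSum s = if E.numComponents s = 1 then 1 else 0 := by
  classical
  rw [stateSum, Finset.sum_eq_single (smoothed s).toFinset]
  · have : ∏ c, E.stateWeight (smoothed s) c (s c) = 1 := by
      refine Finset.prod_eq_one fun c _ => ?_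
      cases hc : s c <;> simp [stateWeight, smoothed, hc]
    simp only [Set.coe_toFinset, this, numComponents]
    exact if_congr Iff.rfl rfl rfl
  · intro T _ hT
    split_ifs with h1
    · by_cases hsub : smoothed s ⊆ (T : Set (Fin N))
      · obtain ⟨c, hc⟩ := hs.exists_stateWeight_eq_zero E h1 hsub
          (fun h => hT (by ext; simp [← h]))
        exact Finset.prod_eq_zero (Finset.mem_univ c) hc
      · obtain ⟨c, hc, hcT⟩ := Set.not_subset.1 hsub
        refine Finset.prod_eq_zero (Finset.mem_univ c) ?_
        have hc' : s c = .smooth := hc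
        rw [hc']
        exact if_neg hcT
    · rfl
  · simp

/-- The skein relation determines the Conway polynomial: it is the state sum. -/
theorem HasConway.eq_stateSum {s : Fin N → CrossingState} {p : ℤ[X]} (h : E.HasConway s p) :
    p = E.stateSum s := by
  induction h with
  | unlink s h => exact (E.stateSum_of_descending h).symm
  | skeinPos s c p q h _ _ ihp ihq =>
    have h1 := E.stateSum_skein s c
    rw [← h, Function.update_eq_self, ← ihp, ← ihq] at h1
    linear_combination -h1
  | skeinNeg s c p q h _ _ ihp ihq =>
    have h1 := E.stateSum_skein s c
    rw [← h, Function.update_eq_self, ← ihp, ← ihq] at h1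
    linear_combination h1

theorem conwayPolynomial_eq_stateSum (s : Fin N → CrossingState) :
    E.conwayPolynomial s = E.stateSum s := by
  have h := E.exists_hasConway s
  rw [conwayPolynomial, dif_pos h]
  exact HasConway.eq_stateSum E h.choose_spec

end FlatStringDiagram

/-! ### Singular string links and the theorem -/

/-- The `n`-th coefficient of the Conway polynomial of a singular string link with `n` double points
counts whether smoothing all double points yields one component. -/
theorem SingularStringLink.conwayCoeff_eq {k n : ℕ} [NeZero k] (S : SingularStringLink k n) :
    S.conwayCoeff n = if S.diagram.numCircles (Set.range S.double) = 1 then 1 else 0 := by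
  classical
  let s' : Fin S.N → CrossingState := fun c =>
    if c ∈ Set.range S.double then .smooth else if S.sign c then .pos else .neg
  have hsm : FlatStringDiagram.smoothed s' = Set.range S.double := by
    ext c
    by_cases hc : c ∈ Set.range S.double
    · simp only [FlatStringDiagram.smoothed, s', Set.mem_ofPred_eq, hc, if_true]
    · cases h : S.sign c <;> simp [FlatStringDiagram.smoothed, s', hc, h] <;> simpa using hc
  have h1 := S.diagram.sum_resolve_stateSum S.double S.sign S.resolve (fun _ _ => rfl) s'
    (fun j => by simp [s']) (fun c hc => if_neg hc)
  have h2 := congrArg (fun p => p.coeff n) h1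
  simp only [finsetSum_coeff] at h2
  have h3 : (X ^ n * S.diagram.stateSum s' : ℤ[X]).coeff n = (S.diagram.stateSum s').coeff 0 := by
    simpa using coeff_X_pow_mul (S.diagram.stateSum s') n 0
  rw [h3, FlatStringDiagram.stateSum_coeff_zero, FlatStringDiagram.numComponents, hsm] at h2
  rw [← h2, conwayCoeff]
  refine Finset.sum_congr rfl fun ε _ => ?_
  rw [FlatStringDiagram.conwayPolynomial_eq_stateSum]
  have : (∏ j, if ε j then (1 : ℤ[X]) else -1) = C (∏ j, if ε j then (1 : ℤ) else -1) := by
    rw [map_prod]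
    exact Finset.prod_congr rfl fun j _ => by split_ifs <;> simp
  rw [this, coeff_C_mul]

/-- For every chord diagram `D` of degree `n` on a string link with two components, the value
`C(D)` of the Conway weight system (the value of the `n`-th coefficient of the Conway polynomial
on every singular string link with chord diagram `D`) is the residue modulo 2 of the product of the
determinant and the rank of the adjacency matrix over `ℤ/2` of the intersection graph. -/
theorem theoremT {n : ℕ} (D : StringChordDiagram 2 n) :
    (∀ S : SingularStringLink 2 n, S.HasChordDiagram D → S.conwayCoeff n = D.conwayWeight) ∧
      D.conwayWeight =
        ((D.intersectionGraph.adj.det * (D.intersectionGraph.adj.rank : ZMod 2)).val : ℤ) := by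
  refine ⟨?_, D.conwayWeight_eq⟩
  rintro S ⟨f, hf, hd⟩
  rw [S.conwayCoeff_eq, D.numCircles_range S.diagram.toStringChordDiagram S.double f hf hd]
  rfl
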